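/- **Theorem 4.5.** Let $\widehat{\mathbb C}=\mathbb C\cup\{\infty\}$ be the Riemann sphere. For a finite Borel measure $\mu$ on $\mathbb C$ with compact support let $I(\mu)=\iint \log|z-w|\,d\mu(z)\,d\mu(w)\in[-\infty,\infty)$ (with $\log 0=-\infty$). A set $A\subseteq\mathbb C$ is called polar if $I(\mu)=-\infty$ for every finite Borel measure $\mu\neq 0$ whose support is a compact subset of $A$, and a set $E\subseteq\widehat{\mathbb C}$ is called polar if $E\setminus\{\infty\}$ is polar in $\mathbb C$. Let $E$ be a compact polar subset of $\widehat{\mathbb C}$, and let $f$ be a conformal map on $\widehat{\mathbb C}\setminus E$, that is, an injective holomorphic map $f:\widehat{\mathbb C}\setminus E\to\widehat{\mathbb C}$. Then $f$ extends to a Möbius map of $\widehat{\mathbb C}$: there are $a,b,c,d\in\mathbb C$ with $ad-bc\neq 0$ such that $f(z)=\dfrac{az+b}{cz+d}$ for all $z\in\widehat{\mathbb C}\setminus E$ (with the usual conventions at $\infty$). -/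

import Mathlib

open MeasureTheory
open scoped Manifold ContDiff ENNReal MatrixGroups

noncomputable section

namespace RiemannSphere

/-! ### The Riemann sphere `OnePoint ℂ` as a complex manifold -/

/-- The inversion `z ↦ 1 / z` of the Riemann sphere, exchanging `0` and `∞`. -/
def inversion (p : OnePoint ℂ) : OnePoint ℂ :=
  p.elim ((0 : ℂ) : OnePoint ℂ) (fun z => if z = 0 then OnePoint.infty else ((z⁻¹ : ℂ) : OnePoint ℂ))

@[simp] lemma inversion_infty : inversion OnePoint.infty = ((0 : ℂ) : OnePoint ℂ) := rfl

@[simp] lemma inversion_zero : inversion ((0 : ℂ) : OnePoint ℂ) = OnePoint.infty := by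
  simp [inversion]

lemma inversion_coe {z : ℂ} (hz : z ≠ 0) :
    inversion (z : OnePoint ℂ) = ((z⁻¹ : ℂ) : OnePoint ℂ) := by
  simp [inversion, hz]

lemma inversion_inversion (p : OnePoint ℂ) : inversion (inversion p) = p := by
  induction p using OnePoint.rec with
  | infty => simp
  | coe z =>
    by_cases hz : z = 0
    · simp [hz]
    · rw [inversion_coe hz, inversion_coe (inv_ne_zero hz), inv_inv]

lemma tendsto_coe_cobounded :
    Filter.Tendsto ((↑) : ℂ → OnePoint ℂ) (Bornology.cobounded ℂ) (nhds OnePoint.infty) := by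
  rw [OnePoint.nhds_infty_eq, Filter.coclosedCompact_eq_cocompact,
    ← Metric.cobounded_eq_cocompact]
  exact Filter.tendsto_map.mono_right le_sup_left

lemma continuous_inversion : Continuous inversion := by
  rw [continuous_iff_continuousAt]
  intro p
  induction p using OnePoint.rec with
  | infty =>
    rw [OnePoint.continuousAt_infty', Filter.coclosedCompact_eq_cocompact,
      ← Metric.cobounded_eq_cocompact, inversion_infty]
    have h : Filter.Tendsto (fun z : ℂ => ((z⁻¹ : ℂ) : OnePoint ℂ)) (Bornology.cobounded ℂ)
        (nhds ((0 : ℂ) : OnePoint ℂ)) :=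
      (OnePoint.continuous_coe.tendsto 0).comp Filter.tendsto_inv₀_cobounded
    refine h.congr' ?_
    filter_upwards [Bornology.eventually_ne_cobounded (0 : ℂ)] with z hz
    exact (inversion_coe hz).symm
  | coe z =>
    rw [OnePoint.continuousAt_coe]
    by_cases hz : z = 0
    · subst hz
      rw [continuousAt_iff_punctured_nhds]
      have h : Filter.Tendsto (fun z : ℂ => ((z⁻¹ : ℂ) : OnePoint ℂ)) (nhdsWithin 0 {0}ᶜ)
          (nhds OnePoint.infty) := tendsto_coe_cobounded.comp Filter.tendsto_inv₀_nhdsNE_zero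
      simp only [Function.comp_apply, inversion_zero]
      refine h.congr' ?_
      filter_upwards [self_mem_nhdsWithin] with w hw
      exact (inversion_coe hw).symm
    · have h : ContinuousAt (fun z : ℂ => ((z⁻¹ : ℂ) : OnePoint ℂ)) z :=
        OnePoint.continuous_coe.continuousAt.comp (continuousAt_inv₀ hz)
      refine h.congr ?_
      filter_upwards [isOpen_ne.mem_nhds hz] with w hw
      exact (inversion_coe hw).symm

/-- The inversion as a homeomorphism of the sphere. -/
def inversionHomeomorph : OnePoint ℂ ≃ₜ OnePoint ℂ where
  toFun := inversion
  invFun := inversion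
  left_inv := inversion_inversion
  right_inv := inversion_inversion
  continuous_toFun := continuous_inversion
  continuous_invFun := continuous_inversion

/-- The chart `z ↦ z` on the complement of `∞`. -/
def affineChart : OpenPartialHomeomorph (OnePoint ℂ) ℂ where
  toFun p := p.elim 0 id
  invFun z := (z : OnePoint ℂ)
  source := {OnePoint.infty}ᶜ
  target := Set.univ
  map_source' _ _ := Set.mem_univ _
  map_target' z _ := OnePoint.coe_ne_infty z
  left_inv' p hp := by
    induction p using OnePoint.rec with
    | infty => exact absurd rfl hp
    | coe z => rfl
  right_inv' _ _ := rfl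
  open_source := OnePoint.isClosed_infty.isOpen_compl
  open_target := isOpen_univ
  continuousOn_toFun := by
    intro p hp
    induction p using OnePoint.rec with
    | infty => exact absurd rfl hp
    | coe z =>
      have h : ContinuousAt (fun w : ℂ => w) z := continuousAt_id
      exact (OnePoint.continuousAt_coe.2 h).continuousWithinAt
  continuousOn_invFun := OnePoint.continuous_coe.continuousOn

/-- The chart `z ↦ 1 / z` (with `∞ ↦ 0`) on the complement of `0`. -/
def inftyChart : OpenPartialHomeomorph (OnePoint ℂ) ℂ :=
  inversionHomeomorph.transOpenPartialHomeomorph affineChart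

@[simp] lemma affineChart_coe (z : ℂ) : affineChart (z : OnePoint ℂ) = z := rfl

@[simp] lemma affineChart_source : affineChart.source = {OnePoint.infty}ᶜ := rfl

@[simp] lemma affineChart_target : affineChart.target = Set.univ := rfl

@[simp] lemma affineChart_symm (z : ℂ) : affineChart.symm z = (z : OnePoint ℂ) := rfl

@[simp] lemma inftyChart_apply (p : OnePoint ℂ) : inftyChart p = affineChart (inversion p) := rfl

@[simp] lemma inftyChart_source : inftyChart.source = inversion ⁻¹' {OnePoint.infty}ᶜ := rfl

@[simp] lemma inftyChart_target : inftyChart.target = Set.univ := rfl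

@[simp] lemma inftyChart_symm (z : ℂ) : inftyChart.symm z = inversion (z : OnePoint ℂ) := rfl

open Classical in
/-- The standard charts of the Riemann sphere. -/
instance : ChartedSpace ℂ (OnePoint ℂ) where
  atlas := {affineChart, inftyChart}
  chartAt p := if p = OnePoint.infty then inftyChart else affineChart
  mem_chart_source p := by
    split_ifs with h
    · subst h
      exact OnePoint.coe_ne_infty 0
    · exact h
  chart_mem_atlas p := by
    split_ifs <;> simp

lemma contDiffOn_transition {s : Set ℂ} {g : ℂ → ℂ} (hs : (0 : ℂ) ∉ s)
    (hg : ∀ z ≠ 0, g z = z⁻¹) : ContDiffOn ℂ ω g s := by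
  intro z hz
  have h0 : z ≠ 0 := fun h => hs (h ▸ hz)
  refine ((contDiffAt_inv ℂ h0).congr_of_eventuallyEq ?_).contDiffWithinAt
  filter_upwards [isOpen_ne.mem_nhds h0] with w hw
  exact hg w hw

/-- The Riemann sphere is a complex analytic manifold: the transition maps are `z ↦ z` and
`z ↦ 1 / z`. -/
instance : IsManifold 𝓘(ℂ) ω (OnePoint ℂ) := by
  apply isManifold_of_contDiffOn
  rintro e e' (rfl | rfl) (rfl | rfl)
  · exact contDiffOn_id.congr fun _ _ => by simp
  · exact contDiffOn_transition (by simp) fun z hz => by simp [inversion_coe hz]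
  · exact contDiffOn_transition (by simp) fun z hz => by simp [inversion_coe hz]
  · exact contDiffOn_id.congr fun z _ => by simp [inversion_inversion]

/-- A conformal map on a (sub)domain `U` of the Riemann sphere, with values in the Riemann sphere:
it is holomorphic on `U` and injective, i.e. a holomorphic bijection of `U` onto its image. -/
structure IsConformalOn (f : OnePoint ℂ → OnePoint ℂ) (U : Set (OnePoint ℂ)) : Prop where
  holomorphic : MDifferentiableOn 𝓘(ℂ) 𝓘(ℂ) f U
  injective : Set.InjOn f U

/-! ### Polar sets -/

/-- The logarithmic energy `I(μ) = ∫∫ log |z - w| dμ(z) dμ(w)` with `log 0 = -∞`, the integral being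
that of the positive part minus that of the negative part. (For a finite measure of compact
support, the first of the two is finite.) -/
def energy (μ : Measure ℂ) : EReal :=
  ((∫⁻ w, ∫⁻ z, (ENNReal.log ‖z - w‖ₑ).toENNReal ∂μ ∂μ : ℝ≥0∞) : EReal) -
    ((∫⁻ w, ∫⁻ z, (-ENNReal.log ‖z - w‖ₑ).toENNReal ∂μ ∂μ : ℝ≥0∞) : EReal)

/-- A set `E ⊆ ℂ` is polar if every nonzero finite Borel measure whose support is a compact
subset of `E` has energy `-∞`. -/
def IsPolar (E : Set ℂ) : Prop :=
  ∀ μ : Measure ℂ, IsFiniteMeasure μ → μ ≠ 0 → IsCompact μ.support → μ.support ⊆ E →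
    energy μ = ⊥

/-- A subset `E` of the Riemann sphere is polar if `E ∖ {∞}` is polar in `ℂ`. -/
def IsPolarOnSphere (E : Set (OnePoint ℂ)) : Prop :=
  IsPolar ((↑) ⁻¹' E : Set ℂ)

end RiemannSphere

end

namespace RiemannSphere

open Filter Topology Set

/-! The engine is a Liouville theorem: a bounded holomorphic function off a closed polar set of the
plane is constant (`IsPolar.eq_of_bounded`). Given it, choose a finite point `q` off the set at
which `f` has a finite value `r`. Since `f` is injective, `(f - r)⁻¹` has a simple pole at `q`, and
away from `q` the values of `f` avoid a neighbourhood of `r`. Subtracting the principal part `α / (z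
- q)` therefore leaves a bounded holomorphic function, a constant `β`, and solving for `f` gives a
Möbius map; the value at `∞` follows by continuity.

The Liouville theorem compares energy with Chebyshev constants. Send `q` to `∞` by inversion, so
that `E ∪ {∞}` becomes a compact set `K`. If every monic polynomial of each degree `n` reached `ε ^
n` on `K`, greedily chosen points would have uniformly bounded truncated energy, and a weak limit of
their empirical measures would have finite energy; transported back by inversion, this contradicts
polarity (`IsPolar.exists_prod_lt`). So there are monic polynomials that are very small on `K`. The
maximum principle, applied to a product of powers of such a polynomial and of `(g - g q) / (z - q) ^
k`, forces the first nonzero Taylor coefficient of `g - g q` at `q` to vanish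
(`eventually_const_of_chebyshev`). -/

/-! ### Local form of injective analytic functions -/

/-- An analytic function that is injective near a point has nonzero derivative there. -/
lemma deriv_ne_zero_of_injOn_nhds {s : ℂ → ℂ} {q : ℂ} {U : Set ℂ} (hU : U ∈ 𝓝 q)
    (hs : AnalyticAt ℂ s q) (hinj : InjOn s U) : deriv s q ≠ 0 := by
  intro hd
  have hF : AnalyticAt ℂ (fun z => s z - s q) q := hs.sub analyticAt_const
  have hnz : ¬ ∀ᶠ z in 𝓝 q, s z - s q = 0 := by
    intro h
    have h1 : ∀ᶠ z in 𝓝[≠] q, z = q := by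
      filter_upwards [nhdsWithin_le_nhds h, nhdsWithin_le_nhds hU] with z hz hzU
      exact hinj hzU (mem_of_mem_nhds hU) (sub_eq_zero.1 hz)
    obtain ⟨z, hz, hz'⟩ := (h1.and self_mem_nhdsWithin).exists
    exact hz' hz
  obtain ⟨k, a, ha, haq, hsa⟩ := hF.exists_eventuallyEq_pow_smul_nonzero_iff.2 hnz
  have hk0 : k ≠ 0 := by
    rintro rfl
    have := hsa.self_of_nhds
    simp [haq.symm] at this
  have hk1 : k ≠ 1 := by
    rintro rfl
    have h1 : HasDerivAt (fun z => (z - q) ^ 1 • a z) (a q) q := by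
      have := ((hasDerivAt_id' q).sub_const q).fun_mul ha.differentiableAt.hasDerivAt
      simpa using this
    have h2 : deriv (fun z => s z - s q) q = a q := (Filter.EventuallyEq.deriv_eq hsa).trans h1.deriv
    rw [deriv_sub_const, hd] at h2
    exact haq h2.symm
  have hkC : (k : ℂ) ≠ 0 := Nat.cast_ne_zero.2 hk0
  -- A holomorphic `k`-th root of `a / a q` near `q`; then `s - s q = a q * t ^ k` with `t` a local
  -- coordinate at `q`.
  set b : ℂ → ℂ := fun z => Complex.exp (Complex.log (a z / a q) / k) with hb
  have hbA : AnalyticAt ℂ b q := by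
    have h1 : AnalyticAt ℂ (fun z => a z / a q) q := ha.div analyticAt_const haq
    have h2 : AnalyticAt ℂ (fun z => Complex.log (a z / a q)) q :=
      h1.clog (by simp [div_self haq])
    exact (h2.div analyticAt_const hkC).cexp
  have hbk : ∀ᶠ z in 𝓝 q, a q * b z ^ k = a z := by
    filter_upwards [ha.continuousAt.eventually_ne haq] with z hz
    rw [hb]
    simp only
    rw [← Complex.exp_nat_mul, mul_div_cancel₀ _ hkC, Complex.exp_log (div_ne_zero hz haq),
      mul_div_cancel₀ _ haq]
  have hbq : b q = 1 := by simp [hb, div_self haq]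
  set t : ℂ → ℂ := fun z => (z - q) * b z with ht
  have htA : AnalyticAt ℂ t q := (analyticAt_id.sub analyticAt_const).mul hbA
  have htd : deriv t q = 1 := by
    have := ((hasDerivAt_id q).sub_const q).mul hbA.differentiableAt.hasDerivAt
    simp only [id, sub_self, zero_mul, add_zero, hbq, one_mul] at this
    exact this.deriv
  have hmap : map t (𝓝 q) = 𝓝 0 := by
    have := htA.hasStrictDerivAt.map_nhds_eq (by rw [htd]; exact one_ne_zero)
    simpa [ht] using this
  set V : Set ℂ := {z | z ∈ U ∧ s z - s q = a q * t z ^ k} with hV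
  have hVn : V ∈ 𝓝 q := by
    filter_upwards [hU, hsa, hbk] with z h1 h2 h3
    refine ⟨h1, ?_⟩
    rw [h2, ← h3, ht]
    rw [smul_eq_mul, mul_pow]
    ring
  have hVt : ∀ᶠ w in 𝓝 (0 : ℂ), w ∈ t '' V := hmap ▸ image_mem_map hVn
  -- The coordinates `w` and `ζ * w` have equal `k`-th powers, so two distinct points near `q` share
  -- a value of `s`.
  set ζ : ℂ := Complex.exp (2 * Real.pi * Complex.I / k) with hζ
  have hprim : IsPrimitiveRoot ζ k := Complex.isPrimitiveRoot_exp k hk0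
  have hζ_ne : ζ ≠ 1 := hprim.ne_one (by omega)
  have hζt : ∀ᶠ w in 𝓝 (0 : ℂ), ζ * w ∈ t '' V := by
    have : Tendsto (fun w : ℂ => ζ * w) (𝓝 0) (𝓝 0) := by
      simpa using (continuous_const_mul ζ).tendsto 0
    exact this hVt
  obtain ⟨w, ⟨⟨z₁, h₁, hw₁⟩, ⟨z₂, h₂, hw₂⟩⟩, hw⟩ :=
    (((hVt.and hζt).filter_mono (nhdsWithin_le_nhds (s := {0}ᶜ))).and
      self_mem_nhdsWithin).exists
  have hz : z₁ = z₂ := by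
    refine hinj h₁.1 h₂.1 (sub_left_injective (b := s q) ?_)
    beta_reduce
    rw [h₁.2, h₂.2, hw₁, hw₂, mul_pow, hprim.pow_eq_one, one_mul]
  rw [← hz, hw₁] at hw₂
  have : (ζ - 1) * w = 0 := by rw [sub_mul, ← hw₂]; ring
  exact (mul_ne_zero (sub_ne_zero.2 hζ_ne) hw) this

/-! ### Bounded holomorphic functions: from small polynomials to constancy -/

/-- If `E` is small as seen from `q ∉ E`, in the sense that the image of `E ∪ {∞}` under
`z ↦ (z - q)⁻¹` has vanishing Chebyshev constant, then bounded holomorphic functions off `E` are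
constant near `q`. -/
lemma eventually_const_of_chebyshev {E : Set ℂ} (hE : IsClosed E) {q : ℂ} (hq : q ∉ E)
    (hsmall : ∀ ε : ℝ, 0 < ε → ∃ n : ℕ, n ≠ 0 ∧ ∃ z : ℕ → ℂ,
      ∏ i ∈ Finset.range n, ‖z i‖ < ε ^ n ∧
      ∀ x ∈ E, ∏ i ∈ Finset.range n, ‖(x - q)⁻¹ - z i‖ < ε ^ n)
    {g : ℂ → ℂ} (hg : DifferentiableOn ℂ g Eᶜ) {M : ℝ} (hM : ∀ z ∈ Eᶜ, ‖g z‖ ≤ M) :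
    ∀ᶠ z in 𝓝 q, g z = g q := by
  have hEo : Eᶜ ∈ 𝓝 q := hE.isOpen_compl.mem_nhds hq
  have hM0 : 0 ≤ M := (norm_nonneg _).trans (hM q hq)
  have hF : AnalyticAt ℂ (fun z => g z - g q) q := (hg.analyticAt hEo).sub analyticAt_const
  by_contra hcon
  have hnz : ¬ ∀ᶠ z in 𝓝 q, g z - g q = 0 := by simpa only [sub_eq_zero] using hcon
  obtain ⟨k, a, ha, haq, hga⟩ := hF.exists_eventuallyEq_pow_smul_nonzero_iff.2 hnz
  have hk0 : k ≠ 0 := by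
    rintro rfl
    have := hga.self_of_nhds
    simp [haq.symm] at this
  classical
  set A : ℂ → ℂ := fun z => if z = q then a q else (g z - g q) / (z - q) ^ k with hA
  have hAq : A q = a q := by simp [hA]
  have hAne : ∀ z, z ≠ q → A z = (g z - g q) / (z - q) ^ k := fun z hz => by simp [hA, hz]
  have hAd : ∀ z ∈ Eᶜ, DifferentiableAt ℂ A z := by
    intro z hz
    by_cases hzq : z = q
    · subst hzq
      refine ha.differentiableAt.congr_of_eventuallyEq ?_
      filter_upwards [hga] with w hw
      by_cases hwz : w = z
      · rw [hwz, hAq]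
      · rw [hAne w hwz, hw, smul_eq_mul, mul_div_cancel_left₀]
        exact pow_ne_zero _ (sub_ne_zero.2 hwz)
    · have hgz : DifferentiableAt ℂ g z := hg.differentiableAt (hE.isOpen_compl.mem_nhds hz)
      have : DifferentiableAt ℂ (fun z => (g z - g q) / (z - q) ^ k) z :=
        (hgz.sub_const _).div ((differentiableAt_id.sub_const q).pow k)
          (pow_ne_zero _ (sub_ne_zero.2 hzq))
      refine this.congr_of_eventuallyEq ?_
      filter_upwards [isOpen_ne.mem_nhds hzq] with w hw
      exact hAne w hw
  have key : ∀ ε : ℝ, 0 < ε → ‖a q‖ ≤ 2 * M * ε ^ k := by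
    intro ε hε
    obtain ⟨n, hn, z, hz0, hzE⟩ := hsmall ε hε
    -- This is `(x - q) ^ n * p ((x - q)⁻¹)` for the monic `p` with zeros `z i`, so `R q = 1`.
    set R : ℂ → ℂ := fun x => ∏ i ∈ Finset.range n, (1 - (x - q) * z i) with hR
    have hRd : Differentiable ℂ R := by
      rw [hR]
      fun_prop
    have hRx : ∀ x, x ≠ q →
        ‖R x‖ = ‖x - q‖ ^ n * ∏ i ∈ Finset.range n, ‖(x - q)⁻¹ - z i‖ := by
      intro x hx
      have hx' : x - q ≠ 0 := sub_ne_zero.2 hx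
      have h1 : ∀ i ∈ Finset.range n,
          ‖1 - (x - q) * z i‖ = ‖x - q‖ * ‖(x - q)⁻¹ - z i‖ := by
        intro i _
        rw [← norm_mul, mul_sub, mul_inv_cancel₀ hx']
      rw [hR]
      simp only
      rw [norm_prod, Finset.prod_congr rfl h1, Finset.prod_mul_distrib, Finset.prod_const,
        Finset.card_range]
    have hc1 : Continuous fun x => ε ^ n * ‖x - q‖ ^ n := by fun_prop
    have hc2 : Continuous fun x => ‖R x‖ := hRd.continuous.norm
    -- The region where `p ((x - q)⁻¹)` exceeds `ε ^ n`, together with `q`. Strict smallness of `p`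
    -- on the image of `E` keeps the closure off `E`; smallness of `p` at `0`, the image of `∞`,
    -- makes it bounded.
    set U : Set ℂ := {x | ε ^ n * ‖x - q‖ ^ n < ‖R x‖} with hU
    have hUo : IsOpen U := isOpen_lt hc1 hc2
    have hUcl : closure U ⊆ {x | ε ^ n * ‖x - q‖ ^ n ≤ ‖R x‖} :=
      closure_minimal (fun x hx => (mem_ofPred_eq ▸ hx : _ < _).le) (isClosed_le hc1 hc2)
    have hUE : closure U ⊆ Eᶜ := by
      intro x hx hxE
      have hxq : x ≠ q := fun h => hq (h ▸ hxE)
      have h1 := hUcl hx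
      simp only [mem_ofPred_eq] at h1
      rw [hRx x hxq, mul_comm] at h1
      exact absurd (hzE x hxE)
        (not_lt.2 (le_of_mul_le_mul_left h1 (pow_pos (norm_pos_iff.2 (sub_ne_zero.2 hxq)) n)))
    have hqU : q ∈ U := by simp [hU, hR, hn]
    have hUb : Bornology.IsBounded U := by
      rw [Bornology.isBounded_def]
      have ht : Tendsto (fun x : ℂ => ∏ i ∈ Finset.range n, ‖(x - q)⁻¹ - z i‖)
          (Bornology.cobounded ℂ) (𝓝 (∏ i ∈ Finset.range n, ‖0 - z i‖)) := by
        refine tendsto_finsetProd _ fun i _ => ?_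
        exact ((tendsto_inv₀_cobounded.comp (tendsto_sub_const_cobounded q)).sub_const _).norm
      simp only [zero_sub, norm_neg] at ht
      filter_upwards [ht.eventually_lt_const hz0, Bornology.eventually_ne_cobounded q]
        with x hx hxq
      simp only [hU, mem_compl_iff, mem_ofPred_eq, not_lt]
      rw [hRx x hxq, mul_comm]
      gcongr
    -- The exponents are matched so that the powers of `‖x - q‖` cancel on the frontier, where `‖R
    -- x‖ = ε ^ n * ‖x - q‖ ^ n`.
    set H : ℂ → ℂ := fun x => A x ^ n * R x ^ k with hH
    have hHd : DiffContOnCl ℂ H U := by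
      refine DifferentiableOn.diffContOnCl fun x hx => ?_
      exact (((hAd x (hUE hx)).pow n).mul ((hRd x).pow k)).differentiableWithinAt
    have hfr : ∀ x ∈ frontier U, ‖H x‖ ≤ (2 * M * ε ^ k) ^ n := by
      intro x hx
      have hxcl : x ∈ closure U := frontier_subset_closure hx
      have hxU : x ∉ U := by
        rw [hUo.frontier_eq] at hx
        exact hx.2
      have hxq : x ≠ q := fun h => hxU (h ▸ hqU)
      have hxe : ‖R x‖ = ε ^ n * ‖x - q‖ ^ n := le_antisymm (not_lt.1 hxU) (hUcl hxcl)
      have hpos : ‖x - q‖ ≠ 0 := norm_ne_zero_iff.2 (sub_ne_zero.2 hxq)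
      have h2 : ‖g x - g q‖ ≤ 2 * M := by
        linarith [norm_sub_le (g x) (g q), hM x (hUE hxcl), hM q hq]
      have h3 : ‖H x‖ = (‖g x - g q‖ * ε ^ k) ^ n := by
        simp only [hH, norm_mul, norm_pow, hxe, hAne x hxq, norm_div]
        have hd : ‖x - q‖ ^ (k * n) ≠ 0 := pow_ne_zero _ hpos
        calc (‖g x - g q‖ / ‖x - q‖ ^ k) ^ n * (ε ^ n * ‖x - q‖ ^ n) ^ k
            = (‖g x - g q‖ * ε ^ k) ^ n * (‖x - q‖ ^ (k * n) / ‖x - q‖ ^ (k * n)) := by ring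
          _ = (‖g x - g q‖ * ε ^ k) ^ n := by rw [div_self hd, mul_one]
      rw [h3]
      gcongr
    have hq' := Complex.norm_le_of_forall_mem_frontier_norm_le hUb hHd hfr (subset_closure hqU)
    have hHq : ‖H q‖ = ‖a q‖ ^ n := by simp [hH, hAq, hR]
    rw [hHq] at hq'
    exact (pow_le_pow_iff_left₀ (norm_nonneg _) (by positivity) hn).1 hq'
  have hlim : Tendsto (fun ε : ℝ => 2 * M * ε ^ k) (𝓝[>] 0) (𝓝 (2 * M * 0 ^ k)) :=
    ((continuous_const.mul (continuous_pow k)).tendsto 0).mono_left nhdsWithin_le_nhds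
  rw [zero_pow hk0, mul_zero] at hlim
  have : ‖a q‖ ≤ 0 := ge_of_tendsto hlim (by
    filter_upwards [self_mem_nhdsWithin] with ε hε using key ε hε)
  exact haq (norm_le_zero_iff.1 this)

/-- If all bounded holomorphic functions off the closed set `E` are locally constant, they are all
constant. -/
lemma const_of_forall_eventually_const {E : Set ℂ} (hE : IsClosed E)
    (hloc : ∀ g : ℂ → ℂ, DifferentiableOn ℂ g Eᶜ → (∃ M : ℝ, ∀ z ∈ Eᶜ, ‖g z‖ ≤ M) →
      ∀ q ∈ Eᶜ, ∀ᶠ z in 𝓝 q, g z = g q)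
    {g : ℂ → ℂ} (hg : DifferentiableOn ℂ g Eᶜ) {M : ℝ} (hM : ∀ z ∈ Eᶜ, ‖g z‖ ≤ M)
    {p q : ℂ} (hp : p ∈ Eᶜ) (hq : q ∈ Eᶜ) : g p = g q := by
  by_contra hne
  have hgq := hloc g hg ⟨M, hM⟩ q hq
  have hgp := hloc g hg ⟨M, hM⟩ p hp
  -- Connectedness of the complement is never needed: `h` is again bounded and holomorphic, but near
  -- `p` it equals a nonzero constant over `z - q`, which is not locally constant.
  set h : ℂ → ℂ := fun z => (g z - g q) / (z - q) with hh
  have hhd : DifferentiableOn ℂ h Eᶜ := by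
    intro z hz
    refine DifferentiableAt.differentiableWithinAt ?_
    by_cases hzq : z = q
    · subst hzq
      refine (differentiableAt_const (0 : ℂ)).congr_of_eventuallyEq ?_
      filter_upwards [hgq] with w hw
      simp [hh, hw]
    · exact ((hg.differentiableAt (hE.isOpen_compl.mem_nhds hz)).sub_const _).div
        (differentiableAt_id.sub_const q) (sub_ne_zero.2 hzq)
  have hhb : ∃ M' : ℝ, ∀ z ∈ Eᶜ, ‖h z‖ ≤ M' := by
    obtain ⟨δ, hδ, hb⟩ := Metric.eventually_nhds_iff.1 hgq
    have hM0 : 0 ≤ M := (norm_nonneg _).trans (hM q hq)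
    refine ⟨2 * M / δ, fun z hz => ?_⟩
    by_cases hzd : dist z q < δ
    · simp only [hh, hb hzd, sub_self, zero_div, norm_zero]
      positivity
    · rw [hh]
      simp only
      rw [norm_div]
      have h2 : ‖g z - g q‖ ≤ 2 * M := by
        linarith [norm_sub_le (g z) (g q), hM z hz, hM q hq]
      have h3 : δ ≤ ‖z - q‖ := by rw [← dist_eq_norm]; exact not_lt.1 hzd
      gcongr
  have hhp := hloc h hhd hhb p hp
  obtain ⟨z, ⟨hz1, hz2⟩, hzp⟩ :=
    (((hgp.and hhp).filter_mono (nhdsWithin_le_nhds (s := {p}ᶜ))).and self_mem_nhdsWithin).exists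
  have hc : g p - g q ≠ 0 := sub_ne_zero.2 hne
  simp only [hh, hz1] at hz2
  rw [div_eq_mul_inv, div_eq_mul_inv] at hz2
  exact hzp (sub_left_injective (inv_injective (mul_left_cancel₀ hc hz2)))

/-! ### The truncated logarithmic kernel -/

/-- The negative part of the logarithmic energy. -/
noncomputable def negEnergy (μ : Measure ℂ) : ℝ≥0∞ :=
  ∫⁻ w, ∫⁻ z, (-ENNReal.log ‖z - w‖ₑ).toENNReal ∂μ ∂μ

/-- The logarithmic kernel `-log ‖w‖`, truncated at height `T`. -/
noncomputable def truncLog (T : ℝ) (w : ℂ) : ℝ := -Real.log (max ‖w‖ (Real.exp (-T)))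

lemma max_exp_pos (T : ℝ) (w : ℂ) : 0 < max ‖w‖ (Real.exp (-T)) :=
  lt_max_of_lt_right (Real.exp_pos _)

lemma continuous_truncLog (T : ℝ) : Continuous (truncLog T) :=
  ((continuous_norm.max continuous_const).log fun w => (max_exp_pos T w).ne').neg

lemma truncLog_le (T : ℝ) (w : ℂ) : truncLog T w ≤ T := by
  have := Real.log_le_log (Real.exp_pos (-T)) (le_max_right ‖w‖ (Real.exp (-T)))
  rw [Real.log_exp] at this
  unfold truncLog
  linarith

lemma truncLog_zero (T : ℝ) : truncLog T 0 = T := by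
  simp [truncLog, (Real.exp_pos _).le]

lemma truncLog_le_neg_log (T : ℝ) {w : ℂ} (hw : w ≠ 0) : truncLog T w ≤ -Real.log ‖w‖ :=
  neg_le_neg (Real.log_le_log (norm_pos_iff.2 hw) (le_max_left _ _))

lemma truncLog_neg (T : ℝ) (w : ℂ) : truncLog T (-w) = truncLog T w := by
  simp [truncLog]

lemma truncLog_mono {S T : ℝ} (h : S ≤ T) (w : ℂ) : truncLog S w ≤ truncLog T w := by
  unfold truncLog
  gcongr

lemma log_add_truncLog_nonneg {D T : ℝ} (hD : 1 ≤ D) (hT : 0 ≤ T) {w : ℂ} (hw : ‖w‖ ≤ D) :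
    0 ≤ Real.log D + truncLog T w := by
  have h : max ‖w‖ (Real.exp (-T)) ≤ D :=
    max_le hw ((Real.exp_le_one_iff.2 (by linarith)).trans hD)
  have := Real.log_le_log (max_exp_pos T w) h
  unfold truncLog
  linarith

lemma truncLog_eq {T : ℝ} {w : ℂ} (hw : w ≠ 0) (hT : -Real.log ‖w‖ ≤ T) :
    truncLog T w = -Real.log ‖w‖ := by
  have : Real.exp (-T) ≤ ‖w‖ := by
    rw [← Real.le_log_iff_exp_le (norm_pos_iff.2 hw)]
    linarith
  rw [truncLog, max_eq_left this]

/-- The truncations reach `-log ‖w‖` once `T` is large, and equal `T` at `w = 0`. The shift by `log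
D ≥ 0` only enlarges them; it makes the kernel nonnegative on sets of diameter at most `D`. -/
lemma toENNReal_neg_log_le_iSup {D : ℝ} (hD : 1 ≤ D) (w : ℂ) :
    (-ENNReal.log ‖w‖ₑ).toENNReal ≤
      ⨆ T : ℕ, ENNReal.ofReal (Real.log D + truncLog T w) := by
  have hD0 : 0 ≤ Real.log D := Real.log_nonneg hD
  by_cases hw : w = 0
  · subst hw
    simp only [truncLog_zero]
    refine le_top.trans (top_le_iff.2 (ENNReal.eq_top_of_forall_nnreal_le fun r => ?_))
    obtain ⟨n, hn⟩ := exists_nat_ge (r : ℝ)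
    refine le_iSup_of_le n ?_
    rw [← ENNReal.ofReal_coe_nnreal]
    exact ENNReal.ofReal_le_ofReal (by linarith)
  · obtain ⟨n, hn⟩ := exists_nat_ge (-Real.log ‖w‖)
    refine le_iSup_of_le n ?_
    rw [truncLog_eq hw hn, ← ofReal_norm,
      ENNReal.log_ofReal_of_pos (norm_pos_iff.2 hw), ← EReal.coe_neg, EReal.real_coe_toENNReal]
    exact ENNReal.ofReal_le_ofReal (by linarith)

/-! ### Greedy points and a limit measure of finite energy -/

/-- A greedy sequence of points, each of which keeps a large product of distances to its
predecessors. -/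
lemma exists_greedy_seq {K : Set ℂ} {ε : ℝ}
    (h : ∀ (n : ℕ) (z : ℕ → ℂ), ∃ x ∈ K, ε ^ n ≤ ∏ i ∈ Finset.range n, ‖x - z i‖) :
    ∃ z : ℕ → ℂ, (∀ n, z n ∈ K) ∧ ∀ n, ε ^ n ≤ ∏ i ∈ Finset.range n, ‖z n - z i‖ := by
  choose F hFK hF using h
  -- The value `0` for `i ≥ n` is never seen, as the product runs over `i < n`.
  let step : (n : ℕ) → ((m : ℕ) → m < n → ℂ) → ℂ :=
    fun n ih => F n fun i => if hi : i < n then ih i hi else 0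
  have hz : ∀ n, Nat.strongRec (motive := fun _ => ℂ) step n =
      F n fun i => if i < n then Nat.strongRec (motive := fun _ => ℂ) step i else 0 := by
    intro n
    rw [Nat.strongRec_eq]
    simp [step]
  refine ⟨fun n => Nat.strongRec (motive := fun _ => ℂ) step n, fun n => ?_, fun n => ?_⟩
  · beta_reduce
    rw [hz]
    exact hFK _ _
  · beta_reduce
    have h1 := hF n fun i => if i < n then Nat.strongRec (motive := fun _ => ℂ) step i else 0
    rw [← hz] at h1
    refine h1.trans (Finset.prod_congr rfl fun i hi => ?_).le
    rw [if_pos (Finset.mem_range.1 hi)]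

/-- The greedy bound controls the sum of the new row; the new column equals it by symmetry. The
diagonal entry adds `L + T`, whose `L` is absorbed by the increment `2 * n + 1` of `n ^ 2`, because
`log ε ≤ 0`. -/
lemma sum_truncLog_le {z : ℕ → ℂ} {ε : ℝ} (hε : 0 < ε) (hε1 : ε ≤ 1)
    (hz : ∀ n, ε ^ n ≤ ∏ i ∈ Finset.range n, ‖z n - z i‖) {L T : ℝ} (n : ℕ) :
    ∑ i ∈ Finset.range n, ∑ j ∈ Finset.range n, (L + truncLog T (z i - z j)) ≤
      n ^ 2 * (L - Real.log ε) + n * T := by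
  induction n with
  | zero => simp
  | succ n ih =>
    have hne : ∀ i ∈ Finset.range n, ‖z n - z i‖ ≠ 0 :=
      Finset.prod_ne_zero_iff.1 ((pow_pos hε n).trans_le (hz n)).ne'
    have h1 : ∑ i ∈ Finset.range n, (L + truncLog T (z n - z i)) ≤ n * (L - Real.log ε) := by
      have h2 : ∑ i ∈ Finset.range n, truncLog T (z n - z i) ≤
          ∑ i ∈ Finset.range n, -Real.log ‖z n - z i‖ :=
        Finset.sum_le_sum fun i hi => truncLog_le_neg_log T (norm_ne_zero_iff.1 (hne i hi))
      have h3 := Real.log_le_log (pow_pos hε n) (hz n)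
      rw [Real.log_pow, Real.log_prod hne] at h3
      rw [Finset.sum_neg_distrib] at h2
      rw [Finset.sum_add_distrib, Finset.sum_const, Finset.card_range, nsmul_eq_mul]
      linarith
    have h2 : ∑ i ∈ Finset.range n, (L + truncLog T (z i - z n)) =
        ∑ i ∈ Finset.range n, (L + truncLog T (z n - z i)) :=
      Finset.sum_congr rfl fun i _ => by rw [← truncLog_neg, neg_sub]
    have h3 : ∑ i ∈ Finset.range n, ∑ j ∈ Finset.range (n + 1), (L + truncLog T (z i - z j)) =
        ∑ i ∈ Finset.range n, ∑ j ∈ Finset.range n, (L + truncLog T (z i - z j)) +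
          ∑ i ∈ Finset.range n, (L + truncLog T (z i - z n)) := by
      rw [← Finset.sum_add_distrib]
      exact Finset.sum_congr rfl fun i _ => Finset.sum_range_succ _ _
    have h4 : Real.log ε ≤ 0 := Real.log_nonpos hε.le hε1
    rw [Finset.sum_range_succ, Finset.sum_range_succ, h3, h2, sub_self, truncLog_zero]
    push_cast
    nlinarith

/-- The uniform probability measure on the first `n + 1` terms of a sequence. -/
noncomputable def empiricalMeasure {X : Type*} [MeasurableSpace X] (z : ℕ → X) (n : ℕ) :
    Measure X :=
  ((n + 1 : ℕ) : ℝ≥0∞)⁻¹ • ∑ i ∈ Finset.range (n + 1), Measure.dirac (z i)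

instance {X : Type*} [MeasurableSpace X] (z : ℕ → X) (n : ℕ) :
    IsProbabilityMeasure (empiricalMeasure z n) := by
  constructor
  rw [empiricalMeasure, Measure.smul_apply, Measure.finsetSum_apply]
  simp only [measure_univ, Finset.sum_const, Finset.card_range, nsmul_eq_mul, mul_one,
    smul_eq_mul]
  exact ENNReal.inv_mul_cancel (by simp) (by simp)

lemma lintegral_empiricalMeasure {X : Type*} [MeasurableSpace X] (z : ℕ → X) (n : ℕ)
    {f : X → ℝ≥0∞} (hf : Measurable f) : ∫⁻ x, f x ∂(empiricalMeasure z n) =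
      ((n + 1 : ℕ) : ℝ≥0∞)⁻¹ * ∑ i ∈ Finset.range (n + 1), f (z i) := by
  rw [empiricalMeasure, lintegral_smul_measure, lintegral_finsetSum_measure, smul_eq_mul]
  simp only [lintegral_dirac' _ hf]

/-- A compact set whose Chebyshev constant is positive carries a probability measure of finite
logarithmic energy. -/
lemma exists_negEnergy_lt_top {K : Set ℂ} (hK : IsCompact K) {ε : ℝ} (hε : 0 < ε) (hε1 : ε ≤ 1)
    (h : ∀ (n : ℕ) (z : ℕ → ℂ), ∃ x ∈ K, ε ^ n ≤ ∏ i ∈ Finset.range n, ‖x - z i‖) :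
    ∃ ν : Measure ℂ, IsProbabilityMeasure ν ∧ ν Kᶜ = 0 ∧ negEnergy ν < ⊤ := by
  obtain ⟨z, hzK, hz⟩ := exists_greedy_seq h
  have : CompactSpace K := isCompact_iff_compactSpace.1 hK
  obtain ⟨D₀, hD₀⟩ := hK.isBounded.exists_norm_le
  set D : ℝ := max 1 (2 * D₀) with hD
  have hD1 : 1 ≤ D := le_max_left _ _
  have hKD : ∀ x ∈ K, ∀ y ∈ K, ‖x - y‖ ≤ D := fun x hx y hy => by
    refine le_trans ?_ (le_max_right _ _)
    linarith [norm_sub_le x y, hD₀ x hx, hD₀ y hy]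
  set L : ℝ := Real.log D with hL
  let F : ℕ → C(K × K, NNReal) := fun T =>
    ⟨fun p => Real.toNNReal (L + truncLog T (p.1 - p.2)), by
      have := continuous_truncLog T
      fun_prop⟩
  have hF : ∀ T p, (F T p : ℝ≥0∞) = ENNReal.ofReal (L + truncLog T (p.1 - p.2)) :=
    fun _ _ => rfl
  let u : ℕ → ProbabilityMeasure K := fun n =>
    ⟨empiricalMeasure (fun i => (⟨z i, hzK i⟩ : K)) n, inferInstance⟩
  -- Probability measures on the compact space `K` form a compact space in the weak topology.
  obtain ⟨ν, hν⟩ := exists_clusterPt_of_compactSpace (map u atTop)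
  -- The `1` pays for the diagonal, whose normalized contribution is `T / (n + 1) ≤ 1` when `T ≤ n`.
  set B : ℝ := L - Real.log ε + 1 with hB
  have hcont : ∀ T, Continuous fun μ : ProbabilityMeasure K =>
      ∫⁻ p, (F T p : ℝ≥0∞) ∂((μ.prod μ : ProbabilityMeasure (K × K)) : Measure (K × K)) :=
    fun T => (ProbabilityMeasure.continuous_lintegral_continuousMap (F T)).comp
      (ProbabilityMeasure.continuous_prod.comp (continuous_id.prodMk continuous_id))
  have hprod : ∀ (T : ℕ) (μ : ProbabilityMeasure K),
      ∫⁻ p, (F T p : ℝ≥0∞) ∂((μ.prod μ : ProbabilityMeasure (K × K)) : Measure (K × K)) =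
        ∫⁻ x, ∫⁻ y, (F T (x, y) : ℝ≥0∞) ∂(μ : Measure K) ∂(μ : Measure K) := by
    intro T μ
    rw [ProbabilityMeasure.toMeasure_prod, lintegral_prod]
    exact ((F T).continuous.measurable.coe_nnreal_ennreal).aemeasurable
  have hbound : ∀ T n : ℕ, T ≤ n →
      ∫⁻ x, ∫⁻ y, (F T (x, y) : ℝ≥0∞) ∂(u n : Measure K) ∂(u n : Measure K) ≤
        ENNReal.ofReal B := by
    intro T n hTn
    have hFm : Measurable fun p : K × K => (F T p : ℝ≥0∞) :=
      (F T).continuous.measurable.coe_nnreal_ennreal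
    have e1 : ∀ x : K, ∫⁻ y, (F T (x, y) : ℝ≥0∞) ∂(u n : Measure K) =
        ((n + 1 : ℕ) : ℝ≥0∞)⁻¹ * ∑ j ∈ Finset.range (n + 1),
          (F T (x, ⟨z j, hzK j⟩) : ℝ≥0∞) :=
      fun x => lintegral_empiricalMeasure _ n (hFm.comp measurable_prodMk_left)
    have e2 : Measurable fun x : K => ∫⁻ y, (F T (x, y) : ℝ≥0∞) ∂(u n : Measure K) :=
      hFm.lintegral_prod_right'
    have e3 := lintegral_empiricalMeasure (fun i => (⟨z i, hzK i⟩ : K)) n e2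
    refine e3.le.trans ?_
    simp only [e1]
    simp only [hF]
    have e4 : ∀ i j : ℕ, 0 ≤ L + truncLog T (z i - z j) := fun i j =>
      log_add_truncLog_nonneg hD1 (Nat.cast_nonneg T) (hKD _ (hzK i) _ (hzK j))
    simp only [← ENNReal.ofReal_sum_of_nonneg fun j _ => e4 _ j]
    rw [← Finset.mul_sum, ← ENNReal.ofReal_sum_of_nonneg fun i _ =>
      Finset.sum_nonneg fun j _ => e4 i j]
    have hn : (0 : ℝ) < ((n + 1 : ℕ) : ℝ) := by positivity
    have e5 : ((n + 1 : ℕ) : ℝ≥0∞)⁻¹ = ENNReal.ofReal (((n + 1 : ℕ) : ℝ)⁻¹) := by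
      rw [ENNReal.ofReal_inv_of_pos hn, ENNReal.ofReal_natCast]
    rw [e5, ← ENNReal.ofReal_mul (by positivity), ← ENNReal.ofReal_mul (by positivity)]
    refine ENNReal.ofReal_le_ofReal ?_
    have e6 := sum_truncLog_le hε hε1 hz (L := L) (T := T) (n + 1)
    have e7 : (T : ℝ) ≤ ((n + 1 : ℕ) : ℝ) := by exact_mod_cast hTn.trans (Nat.le_succ n)
    rw [← mul_assoc, ← mul_inv, inv_mul_le_iff₀ (by positivity)]
    refine e6.trans ?_
    rw [hB]
    nlinarith
  have hνF : ∀ T : ℕ,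
      ∫⁻ x, ∫⁻ y, (F T (x, y) : ℝ≥0∞) ∂(ν : Measure K) ∂(ν : Measure K) ≤
        ENNReal.ofReal B := by
    intro T
    rw [← hprod]
    have hcl := MapClusterPt.continuousAt_comp (hcont T).continuousAt hν
    refine isClosed_Iic.mem_of_mapClusterPt hcl ?_
    filter_upwards [eventually_ge_atTop T] with n hn
    simp only [Function.comp_apply, mem_Iic]
    rw [hprod]
    exact hbound T n hn
  refine ⟨(ν : Measure K).map Subtype.val,
    Measure.isProbabilityMeasure_map measurable_subtype_coe.aemeasurable, ?_, ?_⟩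
  · rw [Measure.map_apply measurable_subtype_coe hK.measurableSet.compl]
    simp
  · have hm2 : Measurable fun p : ℂ × ℂ => (-ENNReal.log ‖p.2 - p.1‖ₑ).toENNReal := by
      fun_prop
    have hm : Measurable fun w : ℂ =>
        ∫⁻ z, (-ENNReal.log ‖z - w‖ₑ).toENNReal ∂((ν : Measure K).map Subtype.val) :=
      hm2.lintegral_prod_right'
    rw [negEnergy, lintegral_map hm measurable_subtype_coe]
    have e1 : ∀ w : K, ∫⁻ z, (-ENNReal.log ‖z - w‖ₑ).toENNReal
        ∂((ν : Measure K).map Subtype.val) =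
        ∫⁻ z : K, (-ENNReal.log ‖(z : ℂ) - w‖ₑ).toENNReal ∂(ν : Measure K) := fun w =>
      lintegral_map (f := fun z : ℂ => (-ENNReal.log ‖z - w‖ₑ).toENNReal) (by fun_prop)
        measurable_subtype_coe
    have hmF : ∀ T, Measurable fun p : K × K => (F T p : ℝ≥0∞) := fun T =>
      (F T).continuous.measurable.coe_nnreal_ennreal
    have hmono : ∀ p, Monotone fun T => (F T p : ℝ≥0∞) := fun p S T hST =>
      ENNReal.ofReal_le_ofReal
        (add_le_add le_rfl (truncLog_mono (Nat.cast_le.2 hST) _))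
    calc ∫⁻ w : K, ∫⁻ z, (-ENNReal.log ‖z - w‖ₑ).toENNReal
          ∂((ν : Measure K).map Subtype.val) ∂(ν : Measure K)
        ≤ ∫⁻ w : K, ∫⁻ z : K, ⨆ T : ℕ, (F T (w, z) : ℝ≥0∞)
            ∂(ν : Measure K) ∂(ν : Measure K) := by
          refine lintegral_mono fun w => ?_
          rw [e1]
          refine lintegral_mono fun z => ?_
          rw [← enorm_neg, neg_sub]
          exact toENNReal_neg_log_le_iSup hD1 _
      _ = ∫⁻ w : K, ⨆ T : ℕ, ∫⁻ z : K, (F T (w, z) : ℝ≥0∞)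
            ∂(ν : Measure K) ∂(ν : Measure K) := by
          refine lintegral_congr fun w => ?_
          exact lintegral_iSup (fun T => (hmF T).comp measurable_prodMk_left)
            fun S T hST z => hmono (w, z) hST
      _ = ⨆ T : ℕ, ∫⁻ w : K, ∫⁻ z : K, (F T (w, z) : ℝ≥0∞)
            ∂(ν : Measure K) ∂(ν : Measure K) :=
          lintegral_iSup (fun T => (hmF T).lintegral_prod_right')
            fun S T hST w => lintegral_mono fun z => hmono (w, z) hST
      _ ≤ ENNReal.ofReal B := iSup_le hνF
      _ < ⊤ := ENNReal.ofReal_lt_top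

/-! ### Polar sets have vanishing Chebyshev constant -/

lemma measurable_toENNReal_neg_log :
    Measurable fun p : ℂ × ℂ => (-ENNReal.log ‖p.2 - p.1‖ₑ).toENNReal := by
  fun_prop

lemma negEnergy_eq_top_of_energy_eq_bot {μ : Measure ℂ} (h : energy μ = ⊥) :
    negEnergy μ = ⊤ := by
  by_contra hne
  rw [energy, sub_eq_add_neg, EReal.add_eq_bot_iff, EReal.neg_eq_bot_iff] at h
  rcases h with h | h
  · exact EReal.coe_ennreal_ne_bot _ h
  · exact hne (EReal.coe_ennreal_eq_top_iff.1 h)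

/-- The kernel is infinite on the diagonal, so an atom alone would give infinite energy. -/
lemma measure_singleton_of_negEnergy_lt_top {ν : Measure ℂ} (h : negEnergy ν < ⊤) (a : ℂ) :
    ν {a} = 0 := by
  by_contra hne
  have h1 : ∫⁻ w in {a}, ∫⁻ z in {a}, (-ENNReal.log ‖z - w‖ₑ).toENNReal ∂ν ∂ν ≤ negEnergy ν :=
    (setLIntegral_le_lintegral _ _).trans
      (lintegral_mono fun w => setLIntegral_le_lintegral _ _)
  rw [lintegral_singleton, lintegral_singleton] at h1
  simp only [sub_self, enorm_zero, ENNReal.log_zero, EReal.neg_bot, EReal.toENNReal_top,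
    ENNReal.top_mul hne] at h1
  exact h.not_ge h1

/-- Off `0` the complement is the preimage of the open set `Eᶜ` under the inverse map; a ball about
`q` missing `E` bounds the image. The point `0` stands for `∞`. -/
lemma isCompact_insert_zero_image_inv {E : Set ℂ} (hE : IsClosed E) {q : ℂ} (hq : q ∉ E) :
    IsCompact (insert 0 ((fun z => (z - q)⁻¹) '' E)) := by
  have hset : insert 0 ((fun z => (z - q)⁻¹) '' E) =
      ({0}ᶜ ∩ (fun x : ℂ => q + x⁻¹) ⁻¹' Eᶜ)ᶜ := by
    ext x
    by_cases hx : x = 0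
    · simp [hx]
    · simp only [mem_insert_iff, hx, false_or, mem_image, mem_compl_iff, mem_inter_iff,
        mem_singleton_iff, not_false_eq_true, mem_preimage, true_and, not_not]
      constructor
      · rintro ⟨z, hz, rfl⟩
        simpa using hz
      · intro h
        exact ⟨_, h, by simp⟩
  refine Metric.isCompact_of_isClosed_isBounded ?_ ?_
  · rw [hset, isClosed_compl_iff]
    refine ContinuousOn.isOpen_inter_preimage ?_ isOpen_compl_singleton hE.isOpen_compl
    exact continuousOn_const.add continuousOn_inv₀
  · obtain ⟨δ, hδ, hball⟩ := Metric.isOpen_iff.1 hE.isOpen_compl q hq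
    refine isBounded_iff_forall_norm_le.2 ⟨δ⁻¹, ?_⟩
    rintro x (rfl | ⟨z, hz, rfl⟩)
    · simpa using hδ.le
    · have : δ ≤ ‖z - q‖ := by
        by_contra hlt
        exact hball (by rwa [Metric.mem_ball, dist_eq_norm, ← not_le]) hz
      simp only [norm_inv]
      gcongr

/-- Inversion distorts the logarithmic kernel by a bounded amount on bounded sets. -/
lemma toENNReal_neg_log_inv_sub_inv_le {R : ℝ} (hR : 0 < R) {x y : ℂ} (hx : x ≠ 0) (hy : y ≠ 0)
    (hxR : ‖x‖ ≤ R) (hyR : ‖y‖ ≤ R) :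
    (-ENNReal.log ‖x⁻¹ - y⁻¹‖ₑ).toENNReal ≤
      (-ENNReal.log ‖x - y‖ₑ).toENNReal + ENNReal.ofReal (-Real.log ((R * R)⁻¹)) := by
  have h1 : ‖x - y‖ * (R * R)⁻¹ ≤ ‖x⁻¹ - y⁻¹‖ := by
    rw [inv_sub_inv hx hy, norm_div, norm_mul, norm_sub_rev, div_eq_mul_inv]
    have := norm_pos_iff.2 hx
    have := norm_pos_iff.2 hy
    gcongr
  have h2 : ‖x - y‖ₑ * ENNReal.ofReal (R * R)⁻¹ ≤ ‖x⁻¹ - y⁻¹‖ₑ := by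
    rw [← ofReal_norm, ← ofReal_norm, ← ENNReal.ofReal_mul (norm_nonneg _)]
    exact ENNReal.ofReal_le_ofReal h1
  have h3 := ENNReal.log_le_log h2
  rw [ENNReal.log_mul_add, ENNReal.log_ofReal_of_pos (by positivity)] at h3
  have h4 := EReal.neg_le_neg_iff.2 h3
  rw [EReal.neg_add (Or.inr (EReal.coe_ne_top _)) (Or.inr (EReal.coe_ne_bot _)),
    sub_eq_add_neg (-ENNReal.log ‖x - y‖ₑ), ← EReal.coe_neg] at h4
  refine (EReal.toENNReal_le_toENNReal h4).trans (EReal.toENNReal_add_le.trans ?_)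
  rw [EReal.real_coe_toENNReal]

/-- A closed polar set is invisible, in the sense of Chebyshev constants, from any point of its
complement. -/
lemma IsPolar.exists_prod_lt {E : Set ℂ} (hpolar : IsPolar E) (hE : IsClosed E) {q : ℂ}
    (hq : q ∉ E) {ε : ℝ} (hε : 0 < ε) : ∃ n : ℕ, n ≠ 0 ∧ ∃ z : ℕ → ℂ,
      ∏ i ∈ Finset.range n, ‖z i‖ < ε ^ n ∧
      ∀ x ∈ E, ∏ i ∈ Finset.range n, ‖(x - q)⁻¹ - z i‖ < ε ^ n := by
  wlog hε1 : ε ≤ 1 generalizing ε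
  · obtain ⟨n, hn, z, h0, hz⟩ := this one_pos le_rfl
    have h1 : (1 : ℝ) ^ n ≤ ε ^ n := pow_le_pow_left₀ zero_le_one (le_of_not_ge hε1) n
    exact ⟨n, hn, z, h0.trans_le h1, fun x hx => (hz x hx).trans_le h1⟩
  set K : Set ℂ := insert 0 ((fun z => (z - q)⁻¹) '' E) with hKdef
  have hK : IsCompact K := isCompact_insert_zero_image_inv hE hq
  suffices h : ∃ n : ℕ, n ≠ 0 ∧ ∃ z : ℕ → ℂ,
      ∀ x ∈ K, ∏ i ∈ Finset.range n, ‖x - z i‖ < ε ^ n by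
    obtain ⟨n, hn, z, hz⟩ := h
    refine ⟨n, hn, z, ?_, fun x hx => hz _ (mem_insert_of_mem _ (mem_image_of_mem _ hx))⟩
    simpa using hz 0 (mem_insert _ _)
  by_contra hcon
  push Not at hcon
  obtain ⟨ν, hνp, hνK, hνe⟩ := exists_negEnergy_lt_top hK hε hε1 fun n z => by
    by_cases hn : n = 0
    · exact ⟨0, mem_insert _ _, by simp [hn]⟩
    · exact hcon n hn z
  have hν0 : ν {0} = 0 := measure_singleton_of_negEnergy_lt_top hνe 0
  -- The transported measure needs compact support in the plane, so `ν` is cut off near `0`. Some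
  -- mass survives because `0` is not an atom.
  obtain ⟨m, hm⟩ : ∃ m : ℕ, ν {x : ℂ | 1 / ((m : ℝ) + 1) ≤ ‖x‖} ≠ 0 := by
    by_contra hall
    push Not at hall
    have h1 : (univ : Set ℂ) ⊆ {0} ∪ ⋃ m : ℕ, {x : ℂ | 1 / ((m : ℝ) + 1) ≤ ‖x‖} := by
      intro x _
      by_cases hx : x = 0
      · exact Or.inl hx
      · obtain ⟨m, hm⟩ := exists_nat_one_div_lt (norm_pos_iff.2 hx)
        exact Or.inr (mem_iUnion.2 ⟨m, hm.le⟩)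
    have h2 : ν univ = 0 :=
      measure_mono_null h1 (measure_union_null hν0 (measure_iUnion_null hall))
    simp at h2
  set δ : ℝ := 1 / ((m : ℝ) + 1) with hδ
  have hδ0 : 0 < δ := by positivity
  set S : Set ℂ := {x : ℂ | δ ≤ ‖x‖} ∩ K with hS
  have hSm : MeasurableSet S :=
    (isClosed_le continuous_const continuous_norm).measurableSet.inter hK.measurableSet
  have hνS : ν S ≠ 0 := by
    intro h
    refine hm (measure_mono_null (t := S ∪ Kᶜ) ?_ (measure_union_null h hνK))
    intro x hx
    by_cases hxK : x ∈ K
    · exact Or.inl ⟨hx, hxK⟩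
    · exact Or.inr hxK
  have hS0 : ∀ x ∈ S, x ≠ 0 := fun x hx h => by
    have := hx.1
    simp only [mem_ofPred_eq, h, norm_zero] at this
    linarith
  have hφ : Measurable fun x : ℂ => q + x⁻¹ := by fun_prop
  set μ : Measure ℂ := (ν.restrict S).map fun x => q + x⁻¹ with hμ
  have hμfin : IsFiniteMeasure μ := inferInstance
  have hμ0 : μ ≠ 0 := by
    intro h
    have h1 : μ univ = 0 := by simp [h]
    rw [hμ, Measure.map_apply hφ MeasurableSet.univ] at h1
    simp only [preimage_univ, Measure.restrict_apply_univ] at h1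
    exact hνS h1
  have hQ : IsCompact (E ∩ Metric.closedBall q δ⁻¹) :=
    (isCompact_closedBall q δ⁻¹).inter_left hE
  have hsupp : μ.support ⊆ E ∩ Metric.closedBall q δ⁻¹ := by
    refine Measure.support_subset_of_isClosed hQ.isClosed ?_
    rw [mem_ae_iff, hμ, Measure.map_apply hφ hQ.measurableSet.compl,
      Measure.restrict_apply (hφ hQ.measurableSet.compl)]
    refine measure_mono_null (t := ∅) ?_ measure_empty
    rintro x ⟨hx, hxS⟩
    refine hx ⟨?_, ?_⟩
    · rcases hxS.2 with h | ⟨z, hz, rfl⟩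
      · exact absurd h (hS0 x hxS)
      · simpa using hz
    · have h1 : δ ≤ ‖x‖ := hxS.1
      rw [Metric.mem_closedBall, dist_eq_norm, add_sub_cancel_left, norm_inv]
      gcongr
  have hbot := hpolar μ hμfin hμ0
    (hQ.of_isClosed_subset Measure.isClosed_support hsupp) (hsupp.trans inter_subset_left)
  have htop := negEnergy_eq_top_of_energy_eq_bot hbot
  obtain ⟨R, hR, hKR⟩ := hK.isBounded.exists_pos_norm_le
  set c : ℝ≥0∞ := ENNReal.ofReal (-Real.log ((R * R)⁻¹)) with hc
  have hle : negEnergy μ ≤ negEnergy ν + c := by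
    have hmeas : Measurable fun w : ℂ => ∫⁻ z, (-ENNReal.log ‖z - w‖ₑ).toENNReal ∂μ :=
      measurable_toENNReal_neg_log.lintegral_prod_right'
    rw [negEnergy, hμ, lintegral_map (hμ ▸ hmeas) hφ]
    have e1 : ∀ w : ℂ, ∫⁻ z, (-ENNReal.log ‖z - w‖ₑ).toENNReal
        ∂((ν.restrict S).map fun x => q + x⁻¹) =
        ∫⁻ x in S, (-ENNReal.log ‖q + x⁻¹ - w‖ₑ).toENNReal ∂ν := fun w =>
      lintegral_map (f := fun z : ℂ => (-ENNReal.log ‖z - w‖ₑ).toENNReal) (by fun_prop) hφ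
    simp only [e1, add_sub_add_left_eq_sub]
    calc ∫⁻ y in S, ∫⁻ x in S, (-ENNReal.log ‖x⁻¹ - y⁻¹‖ₑ).toENNReal ∂ν ∂ν
        ≤ ∫⁻ y in S, ∫⁻ x in S, ((-ENNReal.log ‖x - y‖ₑ).toENNReal + c) ∂ν ∂ν := by
          refine setLIntegral_mono' hSm fun y hy => setLIntegral_mono' hSm fun x hx => ?_
          exact toENNReal_neg_log_inv_sub_inv_le hR (hS0 x hx) (hS0 y hy) (hKR x hx.2)
            (hKR y hy.2)
      _ ≤ ∫⁻ y, ∫⁻ x, ((-ENNReal.log ‖x - y‖ₑ).toENNReal + c) ∂ν ∂ν :=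
          (setLIntegral_le_lintegral _ _).trans
            (lintegral_mono fun y => setLIntegral_le_lintegral _ _)
      _ = negEnergy ν + c := by
          simp only [lintegral_add_right _ measurable_const, lintegral_const, measure_univ,
            mul_one, negEnergy]
  exact (hle.trans_lt (ENNReal.add_lt_top.2 ⟨hνe, ENNReal.ofReal_lt_top⟩)).ne htop

/-- Bounded holomorphic functions off a closed polar set are constant. -/
theorem IsPolar.eq_of_bounded {E : Set ℂ} (hpolar : IsPolar E) (hE : IsClosed E) {g : ℂ → ℂ}
    (hg : DifferentiableOn ℂ g Eᶜ) {M : ℝ} (hM : ∀ z ∈ Eᶜ, ‖g z‖ ≤ M) {p q : ℂ}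
    (hp : p ∈ Eᶜ) (hq : q ∈ Eᶜ) : g p = g q :=
  const_of_forall_eventually_const hE
    (fun _ hg' ⟨_, hM'⟩ _ hq' => eventually_const_of_chebyshev hE hq'
      (fun _ hε => hpolar.exists_prod_lt hE hq' hε) hg' hM') hg hM hp hq

/-! ### Conformal maps in coordinates and Möbius maps -/

lemma coe_affineChart {p : OnePoint ℂ} (hp : p ≠ OnePoint.infty) :
    ((affineChart p : ℂ) : OnePoint ℂ) = p :=
  affineChart.left_inv hp

lemma chartAt_coe (z : ℂ) : chartAt ℂ (z : OnePoint ℂ) = affineChart :=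
  if_neg (OnePoint.coe_ne_infty z)

lemma chartAt_infty : chartAt ℂ (OnePoint.infty : OnePoint ℂ) = inftyChart :=
  if_pos rfl

lemma differentiableAt_chart_comp {f : OnePoint ℂ → OnePoint ℂ} {z : ℂ}
    (hf : MDifferentiableAt 𝓘(ℂ) 𝓘(ℂ) f (z : OnePoint ℂ)) :
    DifferentiableAt ℂ (fun w : ℂ => chartAt ℂ (f z) (f w)) z := by
  have h := (mdifferentiableAt_iff _ _).1 hf |>.2
  simp only [writtenInExtChartAt, extChartAt, OpenPartialHomeomorph.extend, chartAt_coe,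
    mfld_simps] at h
  exact differentiableWithinAt_univ.1 h

/-- The Möbius map `p ↦ (p - r)⁻¹` in the affine coordinate, with the value `0` at `p = ∞` (and
the junk value `0` at the pole `p = r`). -/
noncomputable def poleAt (r : ℂ) (p : OnePoint ℂ) : ℂ := p.elim 0 fun w => (w - r)⁻¹

@[simp] lemma poleAt_infty (r : ℂ) : poleAt r OnePoint.infty = 0 := rfl

@[simp] lemma poleAt_coe (r w : ℂ) : poleAt r (w : OnePoint ℂ) = (w - r)⁻¹ := rfl

lemma poleAt_eq_of_ne_zero (r : ℂ) {p : OnePoint ℂ} (hp : p ≠ ((0 : ℂ) : OnePoint ℂ)) :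
    poleAt r p = inftyChart p / (1 - r * inftyChart p) := by
  induction p using OnePoint.rec with
  | infty => simp
  | coe u =>
    have hu : u ≠ 0 := fun h => hp (h ▸ rfl)
    rw [inftyChart_apply, inversion_coe hu, affineChart_coe, poleAt_coe]
    have : 1 - r * u⁻¹ = (u - r) * u⁻¹ := by rw [sub_mul, mul_inv_cancel₀ hu]
    rw [this, div_mul_cancel_right₀ (inv_ne_zero hu)]

/-- Away from `r` the map `poleAt r` is holomorphic in each chart; in the chart at `∞` its
denominator is `1` at `∞` itself. -/
lemma differentiableAt_poleAt_comp {f : OnePoint ℂ → OnePoint ℂ} {r z : ℂ}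
    (hf : MDifferentiableAt 𝓘(ℂ) 𝓘(ℂ) f (z : OnePoint ℂ)) (hr : f z ≠ (r : OnePoint ℂ)) :
    DifferentiableAt ℂ (fun w : ℂ => poleAt r (f w)) z := by
  have hd := differentiableAt_chart_comp hf
  have hc : ContinuousAt (fun w : ℂ => f w) z :=
    ContinuousAt.comp (f := ((↑) : ℂ → OnePoint ℂ)) hf.continuousAt
      OnePoint.continuous_coe.continuousAt
  by_cases hz : f z = OnePoint.infty
  · rw [hz, chartAt_infty] at hd
    have h1 : DifferentiableAt ℂ
        (fun w : ℂ => inftyChart (f w) / (1 - r * inftyChart (f w))) z := by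
      refine hd.div ((hd.const_mul r).const_sub 1) ?_
      simp [hz, inftyChart_apply]
    refine h1.congr_of_eventuallyEq ?_
    have h0 : f z ≠ ((0 : ℂ) : OnePoint ℂ) := hz ▸ (OnePoint.coe_ne_infty 0).symm
    filter_upwards [hc.eventually_ne h0] with w hw
    exact poleAt_eq_of_ne_zero r hw
  · obtain ⟨u, hu⟩ := OnePoint.ne_infty_iff_exists.1 hz
    rw [← hu, chartAt_coe] at hd
    have h1 : DifferentiableAt ℂ (fun w : ℂ => (affineChart (f w) - r)⁻¹) z := by
      refine (hd.sub_const r).inv ?_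
      rw [← hu, affineChart_coe]
      exact sub_ne_zero.2 fun h => hr (by rw [← hu, h])
    refine h1.congr_of_eventuallyEq ?_
    filter_upwards [hc.eventually_ne hz] with w hw
    rw [← poleAt_coe, coe_affineChart hw]

/-- The action of `GL(2, ℂ)` on the sphere is continuous at `∞` along the finite points. -/
lemma tendsto_smul_coe_cobounded (g : GL (Fin 2) ℂ) :
    Tendsto (fun w : ℂ => g • (w : OnePoint ℂ)) (Bornology.cobounded ℂ)
      (𝓝 (g • (OnePoint.infty : OnePoint ℂ))) := by
  have hdet : g 0 0 * g 1 1 - g 0 1 * g 1 0 ≠ 0 := by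
    have := g.det_ne_zero
    rwa [Matrix.det_fin_two] at this
  rw [OnePoint.smul_infty_eq_ite]
  by_cases hc : g 1 0 = 0
  · have ha : g 0 0 ≠ 0 := fun h => hdet (by simp [h, hc])
    have hd : g 1 1 ≠ 0 := fun h => hdet (by simp [h, hc])
    rw [if_pos hc]
    have h1 : Tendsto (fun w : ℂ => g 0 0 / g 1 1 * w + g 0 1 / g 1 1)
        (Bornology.cobounded ℂ) (Bornology.cobounded ℂ) :=
      (tendsto_add_const_cobounded _).comp
        (tendsto_mul_left_cobounded (div_ne_zero ha hd))
    refine (tendsto_coe_cobounded.comp h1).congr fun w => ?_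
    rw [OnePoint.smul_some_eq_ite, hc, zero_mul, zero_add, if_neg hd, Function.comp_apply]
    congr 1
    ring
  · rw [if_neg hc]
    have h0 : Tendsto (fun w : ℂ => g 1 0 * w + g 1 1)
        (Bornology.cobounded ℂ) (Bornology.cobounded ℂ) :=
      (tendsto_add_const_cobounded _).comp (tendsto_mul_left_cobounded hc)
    have h1 : Tendsto (fun w : ℂ => g 0 0 / g 1 0 +
        (g 0 1 - g 0 0 * g 1 1 / g 1 0) * (g 1 0 * w + g 1 1)⁻¹)
        (Bornology.cobounded ℂ) (𝓝 (g 0 0 / g 1 0)) := by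
      simpa using ((tendsto_inv₀_cobounded.comp h0).const_mul _).const_add (g 0 0 / g 1 0)
    refine ((OnePoint.continuous_coe.tendsto _).comp h1).congr' ?_
    filter_upwards [h0.eventually (Bornology.eventually_ne_cobounded (0 : ℂ))] with w hw
    rw [OnePoint.smul_some_eq_ite, if_neg hw, Function.comp_apply]
    congr 1
    field_simp
    ring

/-- Off a closed polar set, a conformal map with finite value `r` at the finite point `q` satisfies
`(f z - r)⁻¹ = α / (z - q) + β`. -/
lemma exists_poleAt_eq {E : Set ℂ} (hE : IsClosed E) (hpolar : IsPolar E)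
    {f : OnePoint ℂ → OnePoint ℂ}
    (hf : ∀ z ∈ Eᶜ, MDifferentiableAt 𝓘(ℂ) 𝓘(ℂ) f (z : OnePoint ℂ))
    (hinj : InjOn (fun z : ℂ => f z) Eᶜ) {q r : ℂ} (hq : q ∈ Eᶜ) (hr : f q = r) :
    ∃ α β : ℂ, α ≠ 0 ∧ ∀ z ∈ Eᶜ, z ≠ q → poleAt r (f z) = α / (z - q) + β := by
  have hc : ∀ z ∈ Eᶜ, ContinuousAt (fun w : ℂ => f w) z := fun z hz =>
    ContinuousAt.comp (f := ((↑) : ℂ → OnePoint ℂ)) (hf z hz).continuousAt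
      OnePoint.continuous_coe.continuousAt
  set U : Set ℂ := {z | z ∈ Eᶜ ∧ f z ≠ OnePoint.infty} with hU
  have hUE : U ⊆ Eᶜ := fun z hz => hz.1
  have hUo : IsOpen U := by
    rw [isOpen_iff_mem_nhds]
    intro z hz
    filter_upwards [hE.isOpen_compl.mem_nhds hz.1, (hc z hz.1).eventually_ne hz.2] with w h1 h2
      using ⟨h1, h2⟩
  have hqU : q ∈ U := ⟨hq, hr ▸ OnePoint.coe_ne_infty r⟩
  have hUq : U ∈ 𝓝 q := hUo.mem_nhds hqU
  set s : ℂ → ℂ := fun w => affineChart (f w) - r with hs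
  have hsf : ∀ w ∈ U, f w = ((s w + r : ℂ) : OnePoint ℂ) := fun w hw => by
    simp [hs, coe_affineChart hw.2]
  have hsd : DifferentiableOn ℂ s U := by
    intro z hz
    have h := differentiableAt_chart_comp (hf z hz.1)
    rw [hsf z hz, chartAt_coe] at h
    exact (h.sub_const r).differentiableWithinAt
  have hsinj : InjOn s U := fun z hz w hw h =>
    hinj hz.1 hw.1 (by simp only [hsf z hz, hsf w hw, h])
  have hsq : s q = 0 := by simp [hs, hr]
  have hsA : AnalyticAt ℂ s q := hsd.analyticAt hUq
  have hd : deriv s q ≠ 0 := deriv_ne_zero_of_injOn_nhds hUq hsA hsinj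
  have hs0 : ∀ w ∈ U, w ≠ q → s w ≠ 0 := fun w hw hwq h =>
    hwq (hsinj hw hqU (h.trans hsq.symm))
  have hSd : DifferentiableOn ℂ (dslope s q) U :=
    (Complex.differentiableOn_dslope hUq).2 hsd
  have hS0 : ∀ w ∈ U, dslope s q w ≠ 0 := by
    intro w hw
    by_cases hwq : w = q
    · rwa [hwq, dslope_same]
    · rw [dslope_of_ne _ hwq, slope_def_field, hsq, sub_zero]
      exact div_ne_zero (hs0 w hw hwq) (sub_ne_zero.2 hwq)
  -- Off `q` this is `(w - q) / s w`, with value `α` at `q`; hence `dslope I q` is `1 / s w - α / (w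
  -- - q)` with its singularity at `q` removed.
  set I : ℂ → ℂ := fun w => (dslope s q w)⁻¹ with hI
  have hId : DifferentiableOn ℂ I U := hSd.inv hS0
  have hJd : DifferentiableOn ℂ (dslope I q) U := (Complex.differentiableOn_dslope hUq).2 hId
  set α : ℂ := (deriv s q)⁻¹ with hα
  have hJ : ∀ w ∈ U, w ≠ q → dslope I q w = poleAt r (f w) - α / (w - q) := by
    intro w hw hwq
    have h1 : w - q ≠ 0 := sub_ne_zero.2 hwq
    rw [dslope_of_ne _ hwq, slope_def_field, hsf w hw, poleAt_coe, add_sub_cancel_right]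
    simp only [hI, dslope_same, dslope_of_ne _ hwq, slope_def_field, hsq, sub_zero, inv_div]
    have := hs0 w hw hwq
    rw [← hα]
    field_simp
  classical
  set g : ℂ → ℂ := fun w => if w = q then dslope I q q else poleAt r (f w) - α / (w - q) with hg
  have hgJ : EqOn g (dslope I q) U := by
    intro w hw
    by_cases hwq : w = q
    · simp [hg, hwq]
    · simp only [hg, if_neg hwq]
      exact (hJ w hw hwq).symm
  have hgd : DifferentiableOn ℂ g Eᶜ := by
    intro z hz
    refine DifferentiableAt.differentiableWithinAt ?_
    by_cases hzq : z = q
    · rw [hzq]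
      exact (hJd.differentiableAt hUq).congr_of_eventuallyEq (hgJ.eventuallyEq_of_mem hUq)
    · have hzr : f z ≠ (r : OnePoint ℂ) := fun h => hzq (hinj hz hq (h.trans hr.symm))
      have h1 : DifferentiableAt ℂ (fun w : ℂ => poleAt r (f w) - α / (w - q)) z :=
        (differentiableAt_poleAt_comp (hf z hz) hzr).sub
          ((differentiableAt_const α).div (differentiableAt_id.sub_const q) (sub_ne_zero.2 hzq))
      refine h1.congr_of_eventuallyEq ?_
      filter_upwards [isOpen_ne.mem_nhds hzq] with w hw
      exact if_neg hw
  have hgb : ∃ M : ℝ, ∀ z ∈ Eᶜ, ‖g z‖ ≤ M := by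
    have hgc : ContinuousAt g q :=
      (hgd.differentiableAt (hE.isOpen_compl.mem_nhds hq)).continuousAt
    set V : Set ℂ := {z | z ∈ U ∧ ‖g z‖ < ‖g q‖ + 1} with hV
    have hVq : V ∈ 𝓝 q := by
      filter_upwards [hUq, hgc.norm.eventually_lt_const (lt_add_one ‖g q‖)] with z h1 h2
        using ⟨h1, h2⟩
    have hsV : s '' V ∈ 𝓝 (0 : ℂ) := by
      have := hsA.hasStrictDerivAt.map_nhds_eq hd
      rw [hsq] at this
      exact this ▸ image_mem_map hVq
    obtain ⟨δ, hδ, hδV⟩ := Metric.mem_nhds_iff.1 hsV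
    obtain ⟨ρ, hρ, hρV⟩ := Metric.mem_nhds_iff.1 hVq
    -- On `V` continuity bounds `g`. Off `V`, injectivity keeps `s` out of the `δ`-ball already
    -- covered by `s '' V`, and `z` stays at distance at least `ρ` from `q`.
    refine ⟨max (‖g q‖ + 1) (δ⁻¹ + ‖α‖ / ρ), fun z hz => ?_⟩
    by_cases hzV : z ∈ V
    · exact hzV.2.le.trans (le_max_left _ _)
    refine le_trans ?_ (le_max_right _ _)
    have hzq : z ≠ q := fun h => hzV (h ▸ mem_of_mem_nhds hVq)
    have h1 : ‖α / (z - q)‖ ≤ ‖α‖ / ρ := by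
      rw [norm_div]
      have : ρ ≤ ‖z - q‖ := by
        by_contra hlt
        exact hzV (hρV (by rwa [Metric.mem_ball, dist_eq_norm, ← not_le]))
      gcongr
    have h2 : ‖poleAt r (f z)‖ ≤ δ⁻¹ := by
      by_cases hfz : f z = OnePoint.infty
      · simpa [hfz] using hδ.le
      · have hzU : z ∈ U := ⟨hz, hfz⟩
        rw [hsf z hzU, poleAt_coe, add_sub_cancel_right, norm_inv]
        have : δ ≤ ‖s z‖ := by
          by_contra hlt
          obtain ⟨v, hv, hvz⟩ := hδV (by simpa using hlt : s z ∈ Metric.ball 0 δ)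
          exact hzV (hsinj hv.1 hzU hvz ▸ hv)
        gcongr
    simp only [hg, if_neg hzq]
    exact (norm_sub_le _ _).trans (add_le_add h2 h1)
  obtain ⟨M, hM⟩ := hgb
  refine ⟨α, g q, inv_ne_zero hd, fun z hz hzq => ?_⟩
  have h := hpolar.eq_of_bounded hE hgd hM hz hq
  rw [← h]
  simp only [hg, if_neg hzq]
  ring

/-- A Möbius map is determined by `(f z - r)⁻¹ = α / (z - q) + β` and `f q = r`. -/
lemma exists_smul_eq_of_poleAt_eq {α : ℂ} (hα : α ≠ 0) (β q r : ℂ) : ∃ g : GL (Fin 2) ℂ,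
    g • (q : OnePoint ℂ) = r ∧ ∀ (z : ℂ) (p : OnePoint ℂ), z ≠ q → p ≠ r →
      poleAt r p = α / (z - q) + β → p = g • (z : OnePoint ℂ) := by
  -- The coefficients come from `p = r + (z - q) / (β * z + α - β * q)`; the determinant is `α`.
  have hdet : (!![r * β + 1, r * α - r * β * q - q; β, α - β * q]).det ≠ 0 := by
    rw [Matrix.det_fin_two_of]
    ring_nf
    exact hα
  set g : GL (Fin 2) ℂ := Matrix.GeneralLinearGroup.mkOfDetNeZero _ hdet
  have h00 : g 0 0 = r * β + 1 := rfl
  have h01 : g 0 1 = r * α - r * β * q - q := rfl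
  have h10 : g 1 0 = β := rfl
  have h11 : g 1 1 = α - β * q := rfl
  refine ⟨g, ?_, ?_⟩
  · have hden : β * q + (α - β * q) = α := add_sub_cancel _ _
    rw [OnePoint.smul_some_eq_ite, h00, h01, h10, h11, hden, if_neg hα]
    congr 1
    field_simp
    ring
  · intro z p hz hp h
    have hz' : z - q ≠ 0 := sub_ne_zero.2 hz
    have hden : β * z + (α - β * q) = (z - q) * poleAt r p := by
      rw [h]
      field_simp
      ring
    have hnum : (r * β + 1) * z + (r * α - r * β * q - q) =
        r * ((z - q) * poleAt r p) + (z - q) := by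
      rw [← hden]
      ring
    rw [OnePoint.smul_some_eq_ite, h00, h01, h10, h11, hnum, hden]
    induction p using OnePoint.rec with
    -- Here `poleAt r p = 0`, so the denominator vanishes and the Möbius map also takes the value
    -- `∞`.
    | infty => simp
    | coe u =>
      have hu : u - r ≠ 0 := sub_ne_zero.2 fun h => hp (h ▸ rfl)
      rw [poleAt_coe, if_neg (mul_ne_zero hz' (inv_ne_zero hu))]
      congr 1
      field_simp
      ring

end RiemannSphere

/-! ### The theorem -/

open RiemannSphere Filter Topology Set

theorem theorem4p5 (E : Set (OnePoint ℂ)) (hE : IsCompact E)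
    (hpolar : RiemannSphere.IsPolarOnSphere E) (f : OnePoint ℂ → OnePoint ℂ)
    (hf : RiemannSphere.IsConformalOn f Eᶜ) :
    ∃ g : GL (Fin 2) ℂ, ∀ z ∈ Eᶜ, f z = g • z := by
  rcases Eᶜ.eq_empty_or_nonempty with hempty | hne
  · exact ⟨1, by simp [hempty]⟩
  have hEo : IsOpen Eᶜ := hE.isClosed.isOpen_compl
  have hd : ∀ p ∈ Eᶜ, MDifferentiableAt 𝓘(ℂ) 𝓘(ℂ) f p := fun p hp =>
    (hf.holomorphic p hp).mdifferentiableAt (hEo.mem_nhds hp)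
  set E₀ : Set ℂ := (↑) ⁻¹' E with hE₀
  have hE₀c : IsClosed E₀ := hE.isClosed.preimage OnePoint.continuous_coe
  have hinj : InjOn (fun z : ℂ => f z) E₀ᶜ := fun z hz w hw h =>
    OnePoint.coe_injective (hf.injective hz hw h)
  -- An injective map takes the value `∞` at most once, while the nonempty open complement has no
  -- isolated finite points.
  obtain ⟨q, hq, hfq⟩ : ∃ q ∈ E₀ᶜ, f q ≠ OnePoint.infty := by
    obtain ⟨q₀, hq₀⟩ := OnePoint.denseRange_coe.exists_mem_open hEo hne
    by_contra! hall
    have h1 : ∀ᶠ z in 𝓝[≠] q₀, z = q₀ := by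
      filter_upwards [nhdsWithin_le_nhds (hE₀c.isOpen_compl.mem_nhds hq₀)] with z hz
      exact hinj hz hq₀ ((hall z hz).trans (hall q₀ hq₀).symm)
    obtain ⟨z, hz, hz'⟩ := (h1.and self_mem_nhdsWithin).exists
    exact hz' hz
  obtain ⟨r, hr⟩ := OnePoint.ne_infty_iff_exists.1 hfq
  obtain ⟨α, β, hα, hαβ⟩ :=
    exists_poleAt_eq hE₀c hpolar (fun z hz => hd z hz) hinj hq hr.symm
  obtain ⟨g, hgq, hg⟩ := exists_smul_eq_of_poleAt_eq hα β q r
  have hfin : ∀ z ∈ E₀ᶜ, f z = g • (z : OnePoint ℂ) := by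
    intro z hz
    by_cases hzq : z = q
    · rw [hzq, hgq, hr]
    · exact hg z (f z) hzq (fun h => hzq (hinj hz hq (h.trans hr))) (hαβ z hz hzq)
  refine ⟨g, fun p hp => ?_⟩
  induction p using OnePoint.rec with
  | coe z => exact hfin z hp
  | infty =>
    have h1 : Tendsto (fun w : ℂ => f w) (Bornology.cobounded ℂ) (𝓝 (f OnePoint.infty)) :=
      (hd _ hp).continuousAt.tendsto.comp tendsto_coe_cobounded
    refine tendsto_nhds_unique h1 ((tendsto_smul_coe_cobounded g).congr' ?_)
    filter_upwards [tendsto_coe_cobounded.eventually (hEo.mem_nhds hp)] with w hw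
    exact (hfin w hw).symm
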